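/- Let $D$ be an integral domain with quotient field $K$, and let $\star$ be a semistar operation on $D$, i.e. a map $E\mapsto E^\star$ on the nonzero $D$-submodules of $K$ such that $(xE)^\star=xE^\star$ for $0\neq x\in K$, $E\subseteq F$ implies $E^\star\subseteq F^\star$, $E\subseteq E^\star$, and $(E^\star)^\star=E^\star$. Definitions. The associated operation of finite type is $E^{\star_f}=\bigcup\{F^\star : F\subseteq E,\ F\neq 0 \text{ finitely generated}\}$. A quasi-$\star$-ideal is a nonzero ideal $I$ of $D$ with $I=I^\star\cap D$; a quasi-$\star$-prime is a (nonzero) prime ideal that is a quasi-$\star$-ideal; a quasi-$\star$-maximal ideal is a maximal element of the set of proper quasi-$\star$-ideals (such an ideal is prime). Let $\mathcal M(\star_f)$ be the set of quasi-$\star_f$-maximal ideals and put $E^{\tilde\star}=\bigcap\{ED_Q : Q\in\mathcal M(\star_f)\}$ (equal to $K$ if $\mathcal M(\star_f)=\emptyset$). Ideals $A,B$ are $\star$-comaximal if $(A+B)^\star=D^\star$. The domain $D$ is $\star$-Dedekind if it satisfies the ascending chain condition on quasi-$\star$-ideals and $(II^{-1})^{\star_f}=D^{\star_f}$ for every nonzero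 finitely generated ideal $I$ of $D$, where $I^{-1}=(D:_K I)$. Theorem. The following are equivalent: (1) $D$ is $\star$-Dedekind. (2) For each nonzero ideal $I$ of $D$ there are a finite (possibly empty) family $P_1,\dots,P_n$ of pairwise $\star_f$-comaximal quasi-$\star_f$-primes of $D$ and nonnegative integers $e_1,\dots,e_n$ such that $$I^{\tilde\star}=(P_1^{e_1}P_2^{e_2}\cdots P_n^{e_n})^{\tilde\star},$$ where the empty product is $D$. Moreover, suppose that (2) holds and let $I$ be a nonzero ideal of $D$ with $I^{\tilde\star}\neq D^{\tilde\star}$. Then there is a factorization of $I^{\tilde\star}$ as in (2) with $P_i^{\tilde\star}\neq D^{\tilde\star}$ and $e_i>0$ for all $i$, and the factorization with these properties is unique up to the order of the factors. -/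

import Mathlib

open scoped Pointwise

/-- A semistar operation on the domain `D` with quotient field `K`: a map on the `D`-submodules of
`K` that is extensive, monotone, idempotent and commutes with multiplication by nonzero elements
of `K`. Semistar operations are maps on the *nonzero* submodules; such a map is extended here to
the zero submodule so that the same axioms hold there (`0 ↦ 0` always works). At nonzero
submodules, and for nonzero ideals, nothing defined below depends on the value at `0`. -/
structure SemistarOperation (D K : Type*) [CommRing D] [Field K] [Algebra D K] where
  toFun : Submodule D K → Submodule D K
  smul' : ∀ (x : K) (E : Submodule D K), x ≠ 0 → toFun (x • E) = x • toFun E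
  mono' : ∀ E F : Submodule D K, E ≤ F → toFun E ≤ toFun F
  le' : ∀ E : Submodule D K, E ≤ toFun E
  idem' : ∀ E : Submodule D K, toFun (toFun E) = toFun E

namespace SemistarOperation

variable {D K : Type*} [CommRing D] [Field K] [Algebra D K]

instance : CoeFun (SemistarOperation D K) (fun _ => Submodule D K → Submodule D K) := ⟨toFun⟩

/-- An inclusion `x f(E) ⊆ f(xE)` for all nonzero `x` is an equality. -/
theorem smul_eq_of_le (f : Submodule D K → Submodule D K)
    (h : ∀ (x : K) (E : Submodule D K), x ≠ 0 → x • f E ≤ f (x • E))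
    (x : K) (E : Submodule D K) (hx : x ≠ 0) : f (x • E) = x • f E := by
  refine le_antisymm (fun y hy => ?_) (h x E hx)
  have h1 : x⁻¹ • y ∈ f (x⁻¹ • (x • E)) :=
    h x⁻¹ (x • E) (inv_ne_zero hx) (Submodule.smul_mem_pointwise_smul y x⁻¹ _ hy)
  rw [smul_smul, inv_mul_cancel₀ hx, one_smul] at h1
  have h2 := Submodule.smul_mem_pointwise_smul _ x _ h1
  rwa [smul_smul, mul_inv_cancel₀ hx, one_smul] at h2

/-- The union `⋃ {F^⋆ | F ⊆ E finitely generated}`. -/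
def finTypeSubmodule (star : SemistarOperation D K) (E : Submodule D K) : Submodule D K where
  carrier := {x | ∃ F : Submodule D K, F.FG ∧ F ≤ E ∧ x ∈ star F}
  zero_mem' := ⟨⊥, Submodule.fg_bot, bot_le, zero_mem _⟩
  add_mem' := by
    rintro x y ⟨F, hF, hFE, hx⟩ ⟨G, hG, hGE, hy⟩
    exact ⟨F ⊔ G, hF.sup hG, sup_le hFE hGE,
      add_mem (star.mono' _ _ le_sup_left hx) (star.mono' _ _ le_sup_right hy)⟩
  smul_mem' := by
    rintro d x ⟨F, hF, hFE, hx⟩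
    exact ⟨F, hF, hFE, Submodule.smul_mem _ d hx⟩

/-- The semistar operation `⋆_f` of finite type associated to `⋆`:
`E ↦ ⋃ {F^⋆ | F ⊆ E finitely generated}`. (Admitting `F = 0` changes nothing for `E ≠ 0`, as
`⋆` is monotone.) -/
def finType (star : SemistarOperation D K) : SemistarOperation D K where
  toFun E := star.finTypeSubmodule E
  smul' := by
    refine smul_eq_of_le (fun E => star.finTypeSubmodule E) ?_
    rintro x E hx y hy
    obtain ⟨z, ⟨F, hF, hFE, hz⟩, rfl⟩ := (Submodule.mem_smul_pointwise_iff_exists _ _ _).1 hy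
    refine ⟨x • F, hF.map _, fun w hw => ?_, ?_⟩
    · obtain ⟨u, hu, rfl⟩ := (Submodule.mem_smul_pointwise_iff_exists _ _ _).1 hw
      exact Submodule.smul_mem_pointwise_smul _ _ _ (hFE hu)
    · rw [star.smul' x F hx]
      exact Submodule.smul_mem_pointwise_smul _ _ _ hz
  mono' := by
    rintro E F hEF x ⟨G, hG, hGE, hx⟩
    exact ⟨G, hG, hGE.trans hEF, hx⟩
  le' E x hx := ⟨Submodule.span D {x}, Submodule.fg_span_singleton x,
    (Submodule.span_singleton_le_iff_mem x E).2 hx,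
    star.le' _ (Submodule.mem_span_singleton_self x)⟩
  idem' := by
    intro E
    apply le_antisymm
    · rintro x ⟨F, hF, hFE, hx⟩
      have key : ∃ G : Submodule D K, G.FG ∧ G ≤ E ∧ F ≤ star G := by
        revert hFE
        clear hx
        induction F, hF using Submodule.fg_induction with
        | singleton y =>
          intro hy
          obtain ⟨G, hG, hGE, hyG⟩ := hy (Submodule.mem_span_singleton_self y)
          exact ⟨G, hG, hGE, (Submodule.span_singleton_le_iff_mem _ _).2 hyG⟩
        | sup M N _ _ h₁ h₂ =>
          intro h
          obtain ⟨G, hG, hGE, h3⟩ := h₁ (le_sup_left.trans h)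
          obtain ⟨H, hH, hHE, h4⟩ := h₂ (le_sup_right.trans h)
          exact ⟨G ⊔ H, hG.sup hH, sup_le hGE hHE,
            sup_le (h3.trans (star.mono' _ _ le_sup_left))
              (h4.trans (star.mono' _ _ le_sup_right))⟩
      obtain ⟨G, hG, hGE, hFG⟩ := key
      refine ⟨G, hG, hGE, ?_⟩
      rw [← star.idem' G]
      exact star.mono' _ _ hFG hx
    · rintro x ⟨F, hF, hFE, hx⟩
      refine ⟨F, hF, fun y hy => ?_, hx⟩
      exact ⟨Submodule.span D {y}, Submodule.fg_span_singleton y,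
        (Submodule.span_singleton_le_iff_mem y E).2 (hFE hy),
        star.le' _ (Submodule.mem_span_singleton_self y)⟩

/-- The extension `E D_Q` of a `D`-submodule `E` of `K` to the localization `D_Q ⊆ K` at a prime
`Q`: the elements `a / s` of `K` with `a ∈ E` and `s ∈ D ∖ Q`. -/
def localize (Q : PrimeSpectrum D) (E : Submodule D K) : Submodule D K where
  carrier := {x | ∃ s : D, s ∉ Q.asIdeal ∧ s • x ∈ E}
  zero_mem' := ⟨1, Q.asIdeal.ne_top_iff_one.1 Q.isPrime.ne_top, by simp⟩
  add_mem' := by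
    rintro x y ⟨s, hs, hx⟩ ⟨t, ht, hy⟩
    refine ⟨s * t, Q.isPrime.mul_notMem hs ht, ?_⟩
    rw [smul_add]
    refine add_mem ?_ ?_
    · rw [mul_comm, mul_smul]
      exact Submodule.smul_mem _ _ hx
    · rw [mul_smul]
      exact Submodule.smul_mem _ _ hy
  smul_mem' := by
    rintro d x ⟨s, hs, hx⟩
    refine ⟨s, hs, ?_⟩
    rw [smul_comm]
    exact Submodule.smul_mem _ _ hx

/-- The spectral semistar operation defined by a set `Δ` of primes of `D`:
`E ↦ ⋂ {E D_Q | Q ∈ Δ}` (the value is `K` if `Δ` is empty). -/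
def spectral (Δ : Set (PrimeSpectrum D)) : SemistarOperation D K where
  toFun E := ⨅ Q ∈ Δ, localize Q E
  smul' := by
    refine smul_eq_of_le (fun E => ⨅ Q ∈ Δ, localize Q E) ?_
    rintro x E hx y hy
    obtain ⟨z, hz, rfl⟩ := (Submodule.mem_smul_pointwise_iff_exists _ _ _).1 hy
    simp only [Submodule.mem_iInf] at hz ⊢
    intro Q hQ
    obtain ⟨s, hs, h⟩ := hz Q hQ
    refine ⟨s, hs, ?_⟩
    rw [smul_comm]
    exact Submodule.smul_mem_pointwise_smul _ _ _ h
  mono' := by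
    intro E F hEF
    refine iInf₂_mono fun Q _ x hx => ?_
    obtain ⟨s, hs, h⟩ := hx
    exact ⟨s, hs, hEF h⟩
  le' E := by
    refine le_iInf₂ fun Q _ x hx => ?_
    exact ⟨1, Q.asIdeal.ne_top_iff_one.1 Q.isPrime.ne_top, by simpa using hx⟩
  idem' := by
    intro E
    apply le_antisymm
    · refine le_iInf₂ fun Q hQ x hx => ?_
      simp only [Submodule.mem_iInf] at hx
      obtain ⟨s, hs, h⟩ := hx Q hQ
      simp only [Submodule.mem_iInf] at h
      obtain ⟨t, ht, h'⟩ := h Q hQ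
      exact ⟨t * s, Q.isPrime.mul_notMem ht hs, by rwa [mul_smul]⟩
    · refine le_iInf₂ fun Q _ x hx => ?_
      exact ⟨1, Q.asIdeal.ne_top_iff_one.1 Q.isPrime.ne_top, by simpa using hx⟩

/-- `I^⋆` for an (integral) ideal `I` of `D`, viewed as a submodule of `K`. -/
def onIdeal (star : SemistarOperation D K) (I : Ideal D) : Submodule D K :=
  star (IsLocalization.coeSubmodule K I)

/-- Quasi-`⋆`-ideals: nonzero ideals `I` of `D` with `I^⋆ ∩ D = I`. -/
def IsQuasiIdeal (star : SemistarOperation D K) (I : Ideal D) : Prop :=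
  I ≠ ⊥ ∧ (star.onIdeal I).comap (Algebra.linearMap D K) = I

/-- Quasi-`⋆`-primes: nonzero prime ideals that are quasi-`⋆`-ideals. -/
def IsQuasiPrime (star : SemistarOperation D K) (P : Ideal D) : Prop :=
  P.IsPrime ∧ star.IsQuasiIdeal P

/-- Quasi-`⋆`-maximal ideals: maximal elements of the set of proper quasi-`⋆`-ideals. -/
def IsQuasiMaximal (star : SemistarOperation D K) (M : Ideal D) : Prop :=
  Maximal (fun I : Ideal D => I ≠ ⊤ ∧ star.IsQuasiIdeal I) M

/-- Quasi-`⋆`-maximal ideals are prime, so that `{Q ∈ Spec D | Q quasi-⋆-maximal}` is the set of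
all quasi-`⋆`-maximal ideals. -/
theorem IsQuasiMaximal.isPrime {star : SemistarOperation D K} {M : Ideal D}
    (hM : star.IsQuasiMaximal M) : M.IsPrime := by
  obtain ⟨⟨hM1, hM0, hMq⟩, hmax⟩ := hM
  refine Ideal.isPrime_iff.2 ⟨hM1, fun {r s} hrs => or_iff_not_imp_left.2 fun hr => ?_⟩
  set A : Ideal D := M ⊔ Ideal.span {r} with hA
  set B : Ideal D := (star.onIdeal A).comap (Algebra.linearMap D K) with hB
  have hAB : A ≤ B := fun a ha => star.le' _ ⟨a, ha, rfl⟩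
  have hMA : M ≤ A := le_sup_left
  have hrB : r ∈ B := hAB (Ideal.mem_sup_right (Ideal.mem_span_singleton_self r))
  have hBq : star.IsQuasiIdeal B := by
    refine ⟨fun h => hM0 (le_bot_iff.1 (h ▸ hMA.trans hAB)), le_antisymm ?_ ?_⟩
    · refine Submodule.comap_mono ?_
      conv_rhs => rw [onIdeal, ← star.idem']
      refine star.mono' _ _ ?_
      rintro _ ⟨b, hb, rfl⟩
      exact hb
    · exact fun b hb => star.le' _ ⟨b, hb, rfl⟩
  have hBtop : B = ⊤ := by
    by_contra hne
    exact hr (hmax ⟨hne, hBq⟩ (hMA.trans hAB) hrB)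
  have h1 : (algebraMap D K) 1 ∈ star.onIdeal A := by
    have : (1 : D) ∈ B := hBtop ▸ Submodule.mem_top
    exact this
  rw [← hMq]
  change algebraMap D K s ∈ star.onIdeal M
  by_cases hs : algebraMap D K s = 0
  · rw [hs]
    exact zero_mem _
  have h2 := Submodule.smul_mem_pointwise_smul _ (algebraMap D K s) _ h1
  rw [onIdeal, ← star.smul' _ _ hs, map_one, smul_eq_mul, mul_one] at h2
  refine star.mono' _ _ ?_ h2
  intro y hy
  obtain ⟨_, ⟨a, ha, rfl⟩, rfl⟩ := (Submodule.mem_smul_pointwise_iff_exists _ _ _).1 hy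
  refine ⟨s * a, ?_, by simp⟩
  obtain ⟨m, hm, c, hc, rfl⟩ := Submodule.mem_sup.1 ha
  obtain ⟨d, rfl⟩ := Ideal.mem_span_singleton'.1 hc
  rw [mul_add, show s * (d * r) = d * (r * s) by ring]
  exact add_mem (M.mul_mem_left _ hm) (M.mul_mem_left _ hrs)

/-- `⋆~`: the spectral semistar operation defined by the quasi-`⋆_f`-maximal ideals. -/
def tilde (star : SemistarOperation D K) : SemistarOperation D K :=
  spectral {Q : PrimeSpectrum D | star.finType.IsQuasiMaximal Q.asIdeal}

/-- `D` is `⋆`-Noetherian: ascending chain condition on quasi-`⋆`-ideals. -/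
def IsNoetherianDomain (star : SemistarOperation D K) : Prop :=
  WellFoundedGT {I : Ideal D // star.IsQuasiIdeal I}

/-- `I` is `⋆`-invertible: `(I I⁻¹)^⋆ = D^⋆`, where `I⁻¹ = (D :_K I)`. -/
def IsInvertibleIdeal (star : SemistarOperation D K) (I : Ideal D) : Prop :=
  star (IsLocalization.coeSubmodule K I *
    ((1 : Submodule D K) / IsLocalization.coeSubmodule K I)) = star 1

/-- `D` is a Prüfer `⋆`-multiplication domain: every nonzero finitely generated ideal of `D` is
`⋆_f`-invertible. -/
def IsPruferMultiplicationDomain (star : SemistarOperation D K) : Prop :=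
  ∀ I : Ideal D, I ≠ ⊥ → I.FG → star.finType.IsInvertibleIdeal I

/-- `D` is a `⋆`-Dedekind domain: `⋆`-Noetherian and a Prüfer `⋆`-multiplication domain. -/
def IsDedekind (star : SemistarOperation D K) : Prop :=
  star.IsNoetherianDomain ∧ star.IsPruferMultiplicationDomain

/-- Ideals `A`, `B` are `⋆`-comaximal: `(A + B)^⋆ = D^⋆`. -/
def Comaximal (star : SemistarOperation D K) (A B : Ideal D) : Prop :=
  star.onIdeal (A ⊔ B) = star 1

/-- `I^{⋆~} = (P₁^{e₁} ⋯ Pₙ^{eₙ})^{⋆~}` with `P₁, …, Pₙ` quasi-`⋆_f`-primes that are pairwise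
`⋆_f`-comaximal, and nonnegative integers `e₁, …, eₙ` (for `n = 0` the product is `D`). -/
structure IsFactorization (star : SemistarOperation D K) (I : Ideal D) {n : ℕ}
    (P : Fin n → Ideal D) (e : Fin n → ℕ) : Prop where
  quasiPrime : ∀ i, star.finType.IsQuasiPrime (P i)
  comaximal : ∀ i j, i ≠ j → star.finType.Comaximal (P i) (P j)
  eq_prod : star.tilde.onIdeal I = star.tilde.onIdeal (∏ i, P i ^ e i)

end SemistarOperation

/-! Both conditions are equivalent to a local one, `IsLocallyDVROfFiniteCharacter`, and
`tilde_onIdeal_eq_iff` is the link: `I` and `J` have the same `⋆~`-closure exactly when they have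
the same extension to `D_Q` for every quasi-`⋆_f`-maximal `Q`.

If `D` is `⋆`-Dedekind, the chain condition replaces an ideal by a finitely generated one up to
`⋆`-closure. Invertibility makes the latter principal at each `Q` and puts its `⋆`-closure inside
its `⋆~`-closure. Hence every `D_Q` is a principal ideal domain, and Zorn's lemma gives finite
character. If ideals factor, comaximality leaves at most one `P_i` under each `Q`, so principal
ideals of `D_Q` are powers of primes, which forces a DVR; the `Q` containing `I` occur among the
`P_i`.

Under the local condition, the factors of `I` are the `Q` containing it, with exponents the
valuations of `I D_Q`; these are determined by `I^⋆~`. Local generators give invertibility, and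
finite character makes ideals finitely generated up to `⋆~`, hence the chain condition. -/

namespace SemistarOperation

/-! ### Closures, quasi-maximal ideals and comaximality. -/

section Basic

variable {D K : Type*} [CommRing D] [Field K] [Algebra D K]

/-- The set of quasi-`⋆_f`-maximal ideals, as a subset of the prime spectrum. -/
def quasiMaximalSpectrum (star : SemistarOperation D K) : Set (PrimeSpectrum D) :=
  {Q | star.finType.IsQuasiMaximal Q.asIdeal}

/-- The ideal `I^⋆ ∩ D`. -/
def closure (star : SemistarOperation D K) (I : Ideal D) : Ideal D :=
  (star.onIdeal I).comap (Algebra.linearMap D K)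

theorem mem_closure {star : SemistarOperation D K} {I : Ideal D} {d : D} :
    d ∈ star.closure I ↔ algebraMap D K d ∈ star.onIdeal I := Iff.rfl

theorem le_closure (star : SemistarOperation D K) (I : Ideal D) : I ≤ star.closure I :=
  fun a ha => star.le' _ ⟨a, ha, rfl⟩

theorem onIdeal_mono (star : SemistarOperation D K) {I J : Ideal D} (h : I ≤ J) :
    star.onIdeal I ≤ star.onIdeal J :=
  star.mono' _ _ (Submodule.map_mono h)

theorem closure_mono (star : SemistarOperation D K) {I J : Ideal D} (h : I ≤ J) :
    star.closure I ≤ star.closure J :=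
  Submodule.comap_mono (star.onIdeal_mono h)

theorem onIdeal_le_of_le_closure (star : SemistarOperation D K) {I J : Ideal D}
    (h : I ≤ star.closure J) : star.onIdeal I ≤ star.onIdeal J := by
  rw [onIdeal, onIdeal, ← star.idem' (IsLocalization.coeSubmodule K J)]
  refine star.mono' _ _ ?_
  rintro _ ⟨a, ha, rfl⟩
  exact h ha

theorem closure_le_of_le_closure (star : SemistarOperation D K) {I J : Ideal D}
    (h : I ≤ star.closure J) : star.closure I ≤ star.closure J :=
  Submodule.comap_mono (star.onIdeal_le_of_le_closure h)

theorem isQuasiIdeal_closure (star : SemistarOperation D K) {I : Ideal D} (h : I ≠ ⊥) :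
    star.IsQuasiIdeal (star.closure I) :=
  ⟨fun h0 => h (le_bot_iff.1 (h0 ▸ star.le_closure I)),
    le_antisymm (star.closure_le_of_le_closure le_rfl) (star.le_closure _)⟩

theorem IsQuasiIdeal.closure_eq {star : SemistarOperation D K} {I : Ideal D}
    (h : star.IsQuasiIdeal I) : star.closure I = I := h.2

theorem one_eq_onIdeal_top (star : SemistarOperation D K) : star 1 = star.onIdeal ⊤ := by
  rw [onIdeal, IsLocalization.coeSubmodule_top]

theorem onIdeal_eq_one_iff {star : SemistarOperation D K} {I : Ideal D} :
    star.onIdeal I = star 1 ↔ star.closure I = ⊤ := by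
  rw [one_eq_onIdeal_top]
  constructor
  · intro h
    rw [Ideal.eq_top_iff_one]
    change algebraMap D K 1 ∈ star.onIdeal I
    rw [h]
    exact star.le_closure ⊤ Submodule.mem_top
  · intro h
    exact le_antisymm (star.onIdeal_mono le_top) (star.onIdeal_le_of_le_closure h.ge)

theorem mul_mem_of_smul_le (star : SemistarOperation D K) {E F : Submodule D K} {x y : K}
    (hx : x ∈ star E) (h : y • E ≤ F) : y * x ∈ star F := by
  by_cases hy : y = 0
  · simp [hy]
  · refine star.mono' _ _ h ?_
    rw [star.smul' _ _ hy]
    exact Submodule.smul_mem_pointwise_smul _ _ _ hx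

theorem finType_le (star : SemistarOperation D K) (E : Submodule D K) :
    star.finType E ≤ star E := by
  rintro x ⟨F, _, hFE, hx⟩
  exact star.mono' _ _ hFE hx

theorem finType_onIdeal_eq_of_fg (star : SemistarOperation D K) {J : Ideal D} (hJ : J.FG) :
    star.finType.onIdeal J = star.onIdeal J :=
  le_antisymm (star.finType_le _) fun _ hx => ⟨_, Submodule.FG.map _ hJ, le_rfl, hx⟩

theorem IsQuasiIdeal.finType {star : SemistarOperation D K} {I : Ideal D}
    (h : star.IsQuasiIdeal I) : star.finType.IsQuasiIdeal I :=
  ⟨h.1, le_antisymm ((Submodule.comap_mono (star.finType_le _)).trans h.2.le)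
    (star.finType.le_closure I)⟩

theorem exists_le_coeSubmodule_of_isChain {c : Set (Ideal D)} (hc : IsChain (· ≤ ·) c)
    (hne : c.Nonempty) {F : Submodule D K} (hF : F.FG)
    (hFc : F ≤ IsLocalization.coeSubmodule K (sSup c)) :
    ∃ J ∈ c, F ≤ IsLocalization.coeSubmodule K J := by
  induction F, hF using Submodule.fg_induction with
  | singleton y =>
    obtain ⟨a, ha, rfl⟩ := hFc (Submodule.mem_span_singleton_self y)
    obtain ⟨J, hJ, haJ⟩ := (Submodule.mem_sSup_of_directed hne hc.directedOn).1 ha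
    exact ⟨J, hJ, (Submodule.span_singleton_le_iff_mem _ _).2 ⟨a, haJ, rfl⟩⟩
  | sup M N _ _ h₁ h₂ =>
    obtain ⟨J, hJ, hMJ⟩ := h₁ (le_sup_left.trans hFc)
    obtain ⟨J', hJ', hNJ⟩ := h₂ (le_sup_right.trans hFc)
    rcases hc.total hJ hJ' with h | h
    · exact ⟨J', hJ', sup_le (hMJ.trans (Submodule.map_mono h)) hNJ⟩
    · exact ⟨J, hJ, sup_le hMJ (hNJ.trans (Submodule.map_mono h))⟩

/-- Finite type is essential here: an element of the closure of the union lies in `F^⋆` for a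
finitely generated `F`, and `F` is already contained in one member of the chain. -/
theorem isQuasiIdeal_finType_sSup {star : SemistarOperation D K} {c : Set (Ideal D)}
    (hc : IsChain (· ≤ ·) c) (hne : c.Nonempty)
    (h : ∀ J ∈ c, star.finType.IsQuasiIdeal J) : star.finType.IsQuasiIdeal (sSup c) := by
  refine ⟨fun h0 => ?_, le_antisymm ?_ (star.finType.le_closure _)⟩
  · obtain ⟨J, hJ⟩ := hne
    exact (h J hJ).1 (le_bot_iff.1 (h0 ▸ le_sSup hJ))
  · rintro d ⟨F, hF, hFc, hd⟩
    obtain ⟨J, hJ, hFJ⟩ := exists_le_coeSubmodule_of_isChain hc hne hF hFc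
    refine le_sSup hJ ?_
    rw [← (h J hJ).closure_eq]
    exact ⟨F, hF, hFJ, hd⟩

theorem exists_quasiMaximal_of_closure_ne_top {star : SemistarOperation D K} {I : Ideal D}
    (hI : I ≠ ⊥) (h : star.finType.closure I ≠ ⊤) :
    ∃ Q ∈ star.quasiMaximalSpectrum, I ≤ Q.asIdeal := by
  have hsup : ∀ c ⊆ {J : Ideal D | J ≠ ⊤ ∧ star.finType.IsQuasiIdeal J}, IsChain (· ≤ ·) c →
      ∀ y ∈ c, ∃ ub ∈ {J : Ideal D | J ≠ ⊤ ∧ star.finType.IsQuasiIdeal J}, ∀ z ∈ c, z ≤ ub := by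
    intro c hcs hc y hy
    refine ⟨sSup c, ⟨?_, isQuasiIdeal_finType_sSup hc ⟨y, hy⟩ fun J hJ => (hcs hJ).2⟩,
      fun J hJ => le_sSup hJ⟩
    rw [Ne, Ideal.eq_top_iff_one, Submodule.mem_sSup_of_directed ⟨y, hy⟩ hc.directedOn]
    rintro ⟨J, hJ, h1⟩
    exact (hcs hJ).1 ((Ideal.eq_top_iff_one J).2 h1)
  obtain ⟨M, hIM, hM⟩ := zorn_le_nonempty₀ _ hsup _ ⟨h, star.finType.isQuasiIdeal_closure hI⟩
  have hM' : star.finType.IsQuasiMaximal M := hM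
  exact ⟨⟨M, hM'.isPrime⟩, hM', (star.finType.le_closure I).trans hIM⟩

theorem quasiMaximalSpectrum_closure_le {star : SemistarOperation D K} {Q : PrimeSpectrum D}
    (hQ : Q ∈ star.quasiMaximalSpectrum) {I : Ideal D} (h : I ≤ Q.asIdeal) :
    star.finType.closure I ≤ Q.asIdeal :=
  (star.finType.closure_mono h).trans hQ.1.2.closure_eq.le

theorem eq_of_le_of_mem_quasiMaximalSpectrum {star : SemistarOperation D K}
    {Q R : PrimeSpectrum D} (hQ : Q ∈ star.quasiMaximalSpectrum)
    (hR : R ∈ star.quasiMaximalSpectrum) (h : Q.asIdeal ≤ R.asIdeal) : Q = R :=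
  PrimeSpectrum.ext (le_antisymm h (hQ.2 hR.1 h))

theorem ne_bot_of_mem_quasiMaximalSpectrum {star : SemistarOperation D K}
    {Q : PrimeSpectrum D} (hQ : Q ∈ star.quasiMaximalSpectrum) : Q.asIdeal ≠ ⊥ :=
  hQ.1.2.1

theorem finType_closure_eq_top_iff {star : SemistarOperation D K} {I : Ideal D} (hI : I ≠ ⊥) :
    star.finType.closure I = ⊤ ↔ ∀ Q ∈ star.quasiMaximalSpectrum, ¬ I ≤ Q.asIdeal := by
  constructor
  · intro h Q hQ hIQ
    exact Q.isPrime.ne_top (top_le_iff.1 (h ▸ quasiMaximalSpectrum_closure_le hQ hIQ))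
  · intro h
    by_contra h'
    obtain ⟨Q, hQ, hIQ⟩ := exists_quasiMaximal_of_closure_ne_top hI h'
    exact h Q hQ hIQ

theorem IsQuasiPrime.exists_le_quasiMaximal {star : SemistarOperation D K} {P : Ideal D}
    (hP : star.finType.IsQuasiPrime P) :
    ∃ Q ∈ star.quasiMaximalSpectrum, P ≤ Q.asIdeal :=
  exists_quasiMaximal_of_closure_ne_top hP.2.1 (by rw [hP.2.closure_eq]; exact hP.1.ne_top)

theorem comaximal_finType_iff {star : SemistarOperation D K} {A B : Ideal D} (hA : A ≠ ⊥) :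
    star.finType.Comaximal A B ↔
      ∀ Q ∈ star.quasiMaximalSpectrum, A ≤ Q.asIdeal → ¬ B ≤ Q.asIdeal := by
  have h : A ⊔ B ≠ ⊥ := fun h => hA (le_bot_iff.1 (h ▸ le_sup_left))
  rw [Comaximal, onIdeal_eq_one_iff, finType_closure_eq_top_iff h]
  simp only [sup_le_iff, not_and]

theorem ne_zero_of_notMem {Q : PrimeSpectrum D} {s : D} (hs : s ∉ Q.asIdeal) : s ≠ 0 := by
  rintro rfl
  exact hs (zero_mem _)

/-- Each `P i` lies in some quasi-maximal ideal, so it is not comaximal with itself. -/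
theorem IsFactorization.injective {star : SemistarOperation D K} {I : Ideal D} {n : ℕ}
    {P : Fin n → Ideal D} {e : Fin n → ℕ} (h : star.IsFactorization I P e) :
    Function.Injective P := by
  intro i j hij
  by_contra hne
  obtain ⟨Q, hQ, hPQ⟩ := (h.quasiPrime i).exists_le_quasiMaximal
  exact (comaximal_finType_iff (h.quasiPrime i).2.1).1 (h.comaximal i j hne) Q hQ hPQ (hij ▸ hPQ)

/-- Among the closures of finitely generated subideals of `I` choose a maximal one; adjoining a
further element of `I` cannot enlarge it. -/
theorem IsNoetherianDomain.exists_fg_le_closure {star : SemistarOperation D K}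
    (h : star.IsNoetherianDomain) {I : Ideal D} (hI : I ≠ ⊥) :
    ∃ J : Ideal D, J ≠ ⊥ ∧ J.FG ∧ J ≤ I ∧ I ≤ star.closure J := by
  obtain ⟨x, hx, hx0⟩ := Submodule.exists_mem_ne_zero_of_ne_bot hI
  have hx' : Ideal.span {x} ≠ ⊥ := by rwa [Ne, Ideal.span_singleton_eq_bot]
  obtain ⟨A, ⟨J, hJ0, hJfg, hJI, hA⟩, hmax⟩ := WellFounded.has_min
    (r := fun A B : {I : Ideal D // star.IsQuasiIdeal I} => A > B) h.wf
    {A | ∃ J : Ideal D, J ≠ ⊥ ∧ J.FG ∧ J ≤ I ∧ A.1 = star.closure J}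
    ⟨⟨_, star.isQuasiIdeal_closure hx'⟩, Ideal.span {x}, hx', Submodule.fg_span_singleton x,
      (Ideal.span_singleton_le_iff_mem _).2 hx, rfl⟩
  refine ⟨J, hJ0, hJfg, hJI, fun y hy => ?_⟩
  have hJ' : J ⊔ Ideal.span {y} ≠ ⊥ := fun h => hJ0 (le_bot_iff.1 (h ▸ le_sup_left))
  have hnot := hmax ⟨_, star.isQuasiIdeal_closure hJ'⟩ ⟨J ⊔ Ideal.span {y}, hJ',
    Submodule.FG.sup hJfg (Submodule.fg_span_singleton y), sup_le hJI ((Ideal.span_singleton_le_iff_mem _).2 hy), rfl⟩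
  have hle : A.1 ≤ star.closure (J ⊔ Ideal.span {y}) := hA ▸ star.closure_mono le_sup_left
  have heq : A.1 = star.closure (J ⊔ Ideal.span {y}) := by
    by_contra hne
    exact hnot (lt_of_le_of_ne hle fun h => hne (congrArg Subtype.val h))
  rw [← hA, heq]
  exact star.le_closure _ (Ideal.mem_sup_right (Ideal.mem_span_singleton_self y))

end Basic

/-! ### The operation `⋆~` in terms of extensions to localizations. -/

section Localization

variable {D K : Type*} [CommRing D] [Field K] [Algebra D K] [IsFractionRing D K]

/-- The extension of the ideal `I` to the localization at the prime `Q`. -/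
abbrev extend (Q : PrimeSpectrum D) (I : Ideal D) : Ideal (Localization.AtPrime Q.asIdeal) :=
  I.map (algebraMap D (Localization.AtPrime Q.asIdeal))

theorem algebraMap_mem_extend_iff {Q : PrimeSpectrum D} {I : Ideal D} {d : D} :
    algebraMap D (Localization.AtPrime Q.asIdeal) d ∈ extend Q I ↔
      ∃ s, s ∉ Q.asIdeal ∧ s * d ∈ I := by
  rw [IsLocalization.algebraMap_mem_map_algebraMap_iff Q.asIdeal.primeCompl]
  rfl

theorem extend_le_iff {Q : PrimeSpectrum D} {I J : Ideal D} :
    extend Q I ≤ extend Q J ↔ ∀ c ∈ I, ∃ s, s ∉ Q.asIdeal ∧ s * c ∈ J := by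
  rw [Ideal.map_le_iff_le_comap]
  exact forall₂_congr fun c _ => algebraMap_mem_extend_iff

theorem mem_closure_tilde_iff {star : SemistarOperation D K} {I : Ideal D} {d : D} :
    d ∈ star.tilde.closure I ↔
      ∀ Q ∈ star.quasiMaximalSpectrum, ∃ s, s ∉ Q.asIdeal ∧ s * d ∈ I := by
  have h : d ∈ star.tilde.closure I ↔ algebraMap D K d ∈
      ⨅ Q ∈ star.quasiMaximalSpectrum, localize Q (IsLocalization.coeSubmodule K I) := Iff.rfl
  simp only [h, Submodule.mem_iInf]
  refine forall₂_congr fun Q _ => exists_congr fun s => and_congr_right fun _ => ?_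
  rw [Algebra.smul_def, ← map_mul]
  constructor
  · rintro ⟨a, ha, hh⟩
    rwa [← IsFractionRing.injective D K hh]
  · exact fun hh => ⟨_, hh, rfl⟩

theorem tilde_onIdeal_le_iff {star : SemistarOperation D K} {I J : Ideal D} :
    star.tilde.onIdeal I ≤ star.tilde.onIdeal J ↔
      ∀ Q ∈ star.quasiMaximalSpectrum, extend Q I ≤ extend Q J := by
  have h : star.tilde.onIdeal I ≤ star.tilde.onIdeal J ↔ I ≤ star.tilde.closure J :=
    ⟨fun h a ha => h (star.tilde.le_closure I ha), star.tilde.onIdeal_le_of_le_closure⟩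
  simp only [h, extend_le_iff]
  exact ⟨fun hh Q hQ c hc => mem_closure_tilde_iff.1 (hh hc) Q hQ,
    fun hh c hc => mem_closure_tilde_iff.2 fun Q hQ => hh Q hQ c hc⟩

theorem tilde_onIdeal_eq_iff {star : SemistarOperation D K} {I J : Ideal D} :
    star.tilde.onIdeal I = star.tilde.onIdeal J ↔
      ∀ Q ∈ star.quasiMaximalSpectrum, extend Q I = extend Q J := by
  simp only [le_antisymm_iff, tilde_onIdeal_le_iff]
  exact ⟨fun h Q hQ => ⟨h.1 Q hQ, h.2 Q hQ⟩, fun h => ⟨fun Q hQ => (h Q hQ).1,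
    fun Q hQ => (h Q hQ).2⟩⟩

theorem extend_eq_top_iff {Q : PrimeSpectrum D} {I : Ideal D} :
    extend Q I = ⊤ ↔ ¬ I ≤ Q.asIdeal := by
  rw [Ideal.eq_top_iff_one, ← map_one (algebraMap D _), algebraMap_mem_extend_iff,
    SetLike.not_le_iff_exists]
  simp only [mul_one]
  exact exists_congr fun s => and_comm

theorem extend_isPrime {Q : PrimeSpectrum D} {P : Ideal D} (hP : P.IsPrime)
    (hPQ : P ≤ Q.asIdeal) : (extend Q P).IsPrime :=
  IsLocalization.isPrime_of_isPrime_disjoint Q.asIdeal.primeCompl _ P hP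
    (Set.disjoint_left.2 fun _ hx hxP => hx (hPQ hxP))

theorem extend_self (Q : PrimeSpectrum D) :
    extend Q Q.asIdeal = IsLocalRing.maximalIdeal (Localization.AtPrime Q.asIdeal) :=
  Localization.AtPrime.map_eq_maximalIdeal

theorem extend_ne_bot [IsDomain D] {Q : PrimeSpectrum D} {I : Ideal D} (h : I ≠ ⊥) : extend Q I ≠ ⊥ := by
  rw [Ne, Ideal.map_eq_bot_iff_of_injective
    (IsLocalization.injective _ Q.asIdeal.primeCompl_le_nonZeroDivisors)]
  exact h

theorem tilde_onIdeal_eq_one_iff {star : SemistarOperation D K} {I : Ideal D} :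
    star.tilde.onIdeal I = star.tilde 1 ↔
      ∀ Q ∈ star.quasiMaximalSpectrum, ¬ I ≤ Q.asIdeal := by
  rw [one_eq_onIdeal_top, tilde_onIdeal_eq_iff]
  refine forall₂_congr fun Q _ => ?_
  rw [← extend_eq_top_iff, extend, extend, Ideal.map_top]

/-- For `d` in the `⋆~`-closure, the conductor `(I : d)` lies in no quasi-maximal ideal, so its
`⋆_f`-closure contains `1`; multiplying by `d` puts `d` in the `⋆_f`-closure of `I`. -/
theorem tilde_closure_le_finType_closure {star : SemistarOperation D K} {I : Ideal D}
    (hI : I ≠ ⊥) : star.tilde.closure I ≤ star.finType.closure I := by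
  intro d hd
  rw [mem_closure_tilde_iff] at hd
  set A : Ideal D := Submodule.comap (LinearMap.mulRight D d) I with hA
  have hIA : I ≤ A := fun a ha => I.mul_mem_right d ha
  have h : star.finType.closure A = ⊤ := by
    rw [finType_closure_eq_top_iff fun h => hI (le_bot_iff.1 (h ▸ hIA))]
    intro Q hQ hAQ
    obtain ⟨s, hs, hsd⟩ := hd Q hQ
    exact hs (hAQ hsd)
  have h1 : algebraMap D K 1 ∈ star.finType.onIdeal A := by
    have : (1 : D) ∈ star.finType.closure A := h ▸ Submodule.mem_top
    exact this
  have h2 := star.finType.mul_mem_of_smul_le (y := algebraMap D K d)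
    (F := IsLocalization.coeSubmodule K I) h1 ?_
  · rwa [map_one, mul_one] at h2
  · intro y hy
    obtain ⟨_, ⟨a, ha, rfl⟩, rfl⟩ := (Submodule.mem_smul_pointwise_iff_exists _ _ _).1 hy
    exact ⟨a * d, ha, by simp [mul_comm]⟩

end Localization

end SemistarOperation

/-! ### Local domains whose principal ideals are prime powers. -/

section LocalDomain

variable {R : Type*} [CommRing R] [IsDomain R] [IsLocalRing R]

open IsLocalRing

/-- In a local domain a factor of a nonzero principal ideal is principal. -/
theorem Ideal.exists_eq_span_singleton_of_mul_eq {I J : Ideal R} {x : R} (hx : x ≠ 0)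
    (h : I * J = Ideal.span {x}) : ∃ b, J = Ideal.span {b} := by
  -- Otherwise `(x) ⊆ 𝔪(x)`, and cancelling `x` puts `1` in `𝔪`. The product `a * b` found here is a
  -- unit times `x`, so `b` generates `J`.
  obtain ⟨a, ha, b, hb, hab⟩ : ∃ a ∈ I, ∃ b ∈ J, a * b ∉ maximalIdeal R * Ideal.span {x} := by
    by_contra! hc
    have hle : Ideal.span {x} ≤ maximalIdeal R * Ideal.span {x} :=
      h.ge.trans (Ideal.mul_le.2 hc)
    obtain ⟨z, hz, hzx⟩ := Ideal.mem_mul_span_singleton.1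
      (hle (Ideal.mem_span_singleton_self x))
    have h1 : z = 1 := mul_right_cancel₀ hx (by rw [hzx, one_mul])
    exact (Ideal.ne_top_iff_one _).1 (maximalIdeal.isMaximal R).ne_top (h1 ▸ hz)
  obtain ⟨u, hu⟩ := Ideal.mem_span_singleton'.1 (h ▸ Ideal.mul_mem_mul ha hb)
  have hu' : IsUnit u := by
    by_contra hnu
    exact hab (Ideal.mem_mul_span_singleton.2 ⟨u, hnu, hu⟩)
  obtain ⟨v, hv⟩ := hu'.exists_right_inv
  have ha0 : a ≠ 0 := by
    rintro rfl
    simp at hab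
  refine ⟨b, le_antisymm (fun c hc => ?_) ((Ideal.span_singleton_le_iff_mem _).2 hb)⟩
  obtain ⟨d, hd⟩ := Ideal.mem_span_singleton'.1 (h ▸ Ideal.mul_mem_mul ha hc)
  refine Ideal.mem_span_singleton'.2 ⟨v * d, mul_left_cancel₀ ha0 ?_⟩
  linear_combination -v * d * hu + hd + d * x * hv

theorem Ideal.exists_prime_of_pow_eq_span_singleton {p : Ideal R} (hp : p.IsPrime) {x : R}
    (hx : x ≠ 0) {n : ℕ} (hn : n ≠ 0) (h : Ideal.span {x} = p ^ n) :
    ∃ π, Prime π ∧ p = Ideal.span {π} := by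
  obtain ⟨k, rfl⟩ := Nat.exists_eq_succ_of_ne_zero hn
  obtain ⟨b, rfl⟩ := Ideal.exists_eq_span_singleton_of_mul_eq hx ((pow_succ p k).symm.trans h.symm)
  have hb : b ≠ 0 := by
    rintro rfl
    refine hx (Ideal.span_singleton_eq_bot.1 ?_)
    rw [h, Ideal.span_singleton_pow, zero_pow hn, Ideal.span_singleton_eq_bot]
  exact ⟨b, (Ideal.span_singleton_prime hb).1 hp, rfl⟩

/-- A local domain that is not a field and in which every nonzero principal ideal is a power of a
prime ideal is a discrete valuation ring. -/
theorem isDiscreteValuationRing_of_forall_span_singleton_eq_pow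
    (hR : maximalIdeal R ≠ ⊥)
    (h : ∀ x : R, x ≠ 0 → ∃ p : Ideal R, p.IsPrime ∧ ∃ n, Ideal.span {x} = p ^ n) :
    IsDiscreteValuationRing R := by
  have key : ∀ x : R, x ≠ 0 → x ∈ maximalIdeal R →
      ∃ π, maximalIdeal R = Ideal.span {π} ∧ ∃ n, Ideal.span {x} = Ideal.span {π} ^ n := by
    have hpow : ∀ x : R, x ≠ 0 → x ∈ maximalIdeal R →
        ∃ π, Prime π ∧ ∃ n, n ≠ 0 ∧ Ideal.span {x} = Ideal.span {π} ^ n := by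
      intro x hx hxm
      obtain ⟨p, hp, n, hn⟩ := h x hx
      have hn0 : n ≠ 0 := by
        rintro rfl
        rw [pow_zero, Ideal.one_eq_top, Ideal.span_singleton_eq_top] at hn
        exact hxm hn
      obtain ⟨π, hπ, rfl⟩ := Ideal.exists_prime_of_pow_eq_span_singleton hp hx hn0 hn
      exact ⟨π, hπ, n, hn0, hn⟩
    intro x hx hxm
    obtain ⟨π, hπ, n, hn0, hn⟩ := hpow x hx hxm
    refine ⟨π, le_antisymm (fun y hy => ?_) ?_, n, hn⟩
    · by_contra hyπ
      rw [Ideal.mem_span_singleton] at hyπ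
      have hy0 : y ≠ 0 := fun h0 => hyπ (h0 ▸ dvd_zero π)
      -- The product `π * y` is also associated to a prime power `ρ ^ k`. Since `π` divides it, `ρ`
      -- is associated to `π`; cancelling `π` makes `y` a unit or a multiple of `π`, both excluded.
      obtain ⟨ρ, hρ, k, hk0, hk⟩ :=
        hpow (π * y) (mul_ne_zero hπ.ne_zero hy0) (Ideal.mul_mem_left _ _ hy)
      rw [Ideal.span_singleton_pow, Ideal.span_singleton_eq_span_singleton] at hk
      have hπρ : Associated π ρ := by
        refine hπ.irreducible.associated_of_dvd hρ.irreducible (hπ.dvd_of_dvd_pow (n := k) ?_)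
        exact (dvd_mul_right π y).trans hk.dvd
      have hk' : Associated (π * y) (π ^ k) := hk.trans (hπρ.symm.pow_pow)
      obtain ⟨j, rfl⟩ := Nat.exists_eq_succ_of_ne_zero hk0
      rw [pow_succ'] at hk'
      have hyj : Associated y (π ^ j) := hk'.of_mul_left (Associated.refl π) hπ.ne_zero
      rcases Nat.eq_zero_or_pos j with rfl | hj
      · rw [pow_zero, associated_one_iff_isUnit] at hyj
        exact hy hyj
      · exact hyπ ((dvd_pow_self π hj.ne').trans hyj.symm.dvd)
    · rw [Ideal.span_singleton_le_iff_mem]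
      exact hπ.not_isUnit
  obtain ⟨y, hy, hy0⟩ := Submodule.exists_mem_ne_zero_of_ne_bot hR
  obtain ⟨π, hπ, -⟩ := key y hy0 hy
  have hπ0 : π ≠ 0 := by
    rintro rfl
    exact hR (by rw [hπ, Ideal.span_singleton_eq_bot])
  refine IsDiscreteValuationRing.ofHasUnitMulPowIrreducibleFactorization
    ⟨π, IsDiscreteValuationRing.irreducible_of_span_eq_maximalIdeal π hπ0 hπ, fun {x} hx => ?_⟩
  by_cases hxm : x ∈ maximalIdeal R
  · obtain ⟨ρ, hρ, n, hn⟩ := key x hx hxm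
    refine ⟨n, ?_⟩
    rw [← Ideal.span_singleton_eq_span_singleton, hn, ← hρ, hπ, Ideal.span_singleton_pow]
  · refine ⟨0, ?_⟩
    rw [pow_zero]
    exact (associated_one_iff_isUnit.2 (by simpa using hxm)).symm

end LocalDomain

namespace SemistarOperation

/-! ### From `⋆`-Dedekind to discrete valuation rings of finite character. -/

section DVR

variable {D K : Type*} [CommRing D] [IsDomain D] [Field K] [Algebra D K]

/-- The localizations of `D` at the quasi-`⋆_f`-maximal ideals are discrete valuation rings, and
every nonzero ideal is contained in only finitely many quasi-`⋆_f`-maximal ideals. -/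
structure IsLocallyDVROfFiniteCharacter (star : SemistarOperation D K) : Prop where
  dvr : ∀ Q ∈ star.quasiMaximalSpectrum,
    IsDiscreteValuationRing (Localization.AtPrime Q.asIdeal)
  finite : ∀ I : Ideal D, I ≠ ⊥ → {Q ∈ star.quasiMaximalSpectrum | I ≤ Q.asIdeal}.Finite

theorem maximalIdeal_ne_bot {star : SemistarOperation D K} {Q : PrimeSpectrum D}
    (hQ : Q ∈ star.quasiMaximalSpectrum) :
    IsLocalRing.maximalIdeal (Localization.AtPrime Q.asIdeal) ≠ ⊥ := by
  rw [← extend_self]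
  exact extend_ne_bot (ne_bot_of_mem_quasiMaximalSpectrum hQ)

/-- If the localization at the quasi-`⋆_f`-maximal ideal `Q` is a discrete valuation ring, then `Q`
is the only nonzero prime contained in `Q`. -/
theorem eq_of_isPrime_of_le {Q : PrimeSpectrum D}
    (hdvr : IsDiscreteValuationRing (Localization.AtPrime Q.asIdeal)) {P : Ideal D}
    (hP : P.IsPrime) (hP0 : P ≠ ⊥) (hPQ : P ≤ Q.asIdeal) : P = Q.asIdeal := by
  have hmax := IsLocalRing.eq_maximalIdeal ((extend_isPrime hP hPQ).isMaximal (extend_ne_bot hP0))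
  rw [← extend_self] at hmax
  refine le_antisymm hPQ fun c hc => ?_
  obtain ⟨s, hs, hsc⟩ := extend_le_iff.1 hmax.ge c hc
  exact (hP.mem_or_mem hsc).resolve_left fun h => hs (hPQ h)

end DVR

section Prufer

variable {D K : Type*} [CommRing D] [Field K] [Algebra D K] [IsFractionRing D K]

/-- The element `a` generates `J` at `Q`. For `a ∈ J` and `n ∈ J⁻¹` with `s = n a ∉ Q`, every `c ∈
J` satisfies `s c = a (n c)`. If no such pair existed, `J J⁻¹ ⊆ Q` and the closure of `Q` would
contain `1`. -/
theorem IsPruferMultiplicationDomain.exists_generator {star : SemistarOperation D K}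
    (h : star.IsPruferMultiplicationDomain) {Q : PrimeSpectrum D}
    (hQ : Q ∈ star.quasiMaximalSpectrum) {J : Ideal D} (hJ : J ≠ ⊥) (hfg : J.FG) :
    ∃ a ∈ J, ∃ s, s ∉ Q.asIdeal ∧ ∀ c ∈ J, ∃ d, s * c = a * d := by
  by_contra! hcon
  have hle : IsLocalization.coeSubmodule K J * ((1 : Submodule D K) /
      IsLocalization.coeSubmodule K J) ≤ IsLocalization.coeSubmodule K Q.asIdeal := by
    rw [Submodule.mul_le]
    rintro _ ⟨a, ha, rfl⟩ n hn
    rw [Submodule.mem_div_iff_forall_mul_mem] at hn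
    obtain ⟨s, hs⟩ := Submodule.mem_one.1 (hn _ ⟨a, ha, rfl⟩)
    refine ⟨s, ?_, by rw [Algebra.linearMap_apply, hs, mul_comm]⟩
    by_contra hsQ
    obtain ⟨c, hc, hcd⟩ := hcon a ha s hsQ
    obtain ⟨d, hd⟩ := Submodule.mem_one.1 (hn _ ⟨c, hc, rfl⟩)
    refine hcd d (IsFractionRing.injective D K ?_)
    rw [map_mul, map_mul, hs, hd, Algebra.linearMap_apply, Algebra.linearMap_apply]
    ring
  have h1 : (1 : D) ∈ star.finType.closure Q.asIdeal := by
    rw [mem_closure, map_one]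
    refine star.finType.mono' _ _ hle ?_
    rw [h J hJ hfg]
    exact star.finType.le' _ (Submodule.one_le.1 le_rfl)
  rw [hQ.1.2.closure_eq] at h1
  exact Q.isPrime.ne_top ((Ideal.eq_top_iff_one _).2 h1)

end Prufer

variable {D K : Type*} [CommRing D] [IsDomain D] [Field K] [Algebra D K] [IsFractionRing D K]

/-- Divisibility in `D_Q` is total: `a` divides `c`, or `c` divides `a` with quotient in the maximal
ideal. -/
theorem IsPruferMultiplicationDomain.mul_eq_mul_or {star : SemistarOperation D K}
    (h : star.IsPruferMultiplicationDomain) {Q : PrimeSpectrum D}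
    (hQ : Q ∈ star.quasiMaximalSpectrum) {a c : D} (ha : a ≠ 0) :
    ∃ u q, u ∉ Q.asIdeal ∧ (u * c = q * a ∨ (q ∈ Q.asIdeal ∧ u * a = q * c)) := by
  have hJ : Ideal.span {a, c} ≠ ⊥ := fun h0 => ha <| by
    have : a ∈ Ideal.span {a, c} := Ideal.subset_span (by simp)
    rwa [h0] at this
  obtain ⟨b, hb, s, hs, hd⟩ := h.exists_generator hQ hJ (Submodule.fg_span (Set.toFinite _))
  obtain ⟨a', ha'⟩ := hd a (Ideal.subset_span (by simp))
  obtain ⟨c', hc'⟩ := hd c (Ideal.subset_span (by simp))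
  obtain ⟨α, β, rfl⟩ := Ideal.mem_span_pair.1 hb
  have hs0 : s ≠ 0 := ne_zero_of_notMem hs
  have hb0 : α * a + β * c ≠ 0 := by
    intro h0
    rw [h0, zero_mul] at ha'
    exact mul_ne_zero hs0 ha ha'
  -- Since `s ∉ Q`, the cofactors `a'` and `c'` are not both in `Q`.
  have hs' : s = α * a' + β * c' := by
    refine mul_right_cancel₀ hb0 ?_
    linear_combination α * ha' + β * hc'
  have hac : a' * c = c' * a := by
    refine mul_left_cancel₀ hs0 ?_
    linear_combination a' * hc' - c' * ha'
  by_cases haQ : a' ∈ Q.asIdeal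
  · refine ⟨c', a', fun hcQ => hs ?_, Or.inr ⟨haQ, hac.symm⟩⟩
    rw [hs']
    exact add_mem (Ideal.mul_mem_left _ _ haQ) (Ideal.mul_mem_left _ _ hcQ)
  · exact ⟨a', c', haQ, Or.inl hac⟩

/-- Let `a` generate `J` at `Q` with denominator `t`. If a closure element `c` is not in `a D_Q`,
then `u a = q c` with `q ∈ Q` and `u ∉ Q`, so `(t u / c) J ⊆ Q`. Applying this multiplier to `c`
puts `t u` in the closure of `Q`, which is `Q`: a contradiction. -/
theorem IsPruferMultiplicationDomain.closure_le_tilde_closure {star : SemistarOperation D K}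
    (h : star.IsPruferMultiplicationDomain) {J : Ideal D} (hJ : J ≠ ⊥) (hfg : J.FG) :
    star.closure J ≤ star.tilde.closure J := by
  intro c hc
  rw [mem_closure, ← star.finType_onIdeal_eq_of_fg hfg] at hc
  rw [mem_closure_tilde_iff]
  intro Q hQ
  obtain ⟨a, ha, t, ht, hta⟩ := h.exists_generator hQ hJ hfg
  have ha0 : a ≠ 0 := by
    rintro rfl
    obtain ⟨x, hx, hx0⟩ := Submodule.exists_mem_ne_zero_of_ne_bot hJ
    obtain ⟨d, hd⟩ := hta x hx
    rw [zero_mul] at hd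
    exact mul_ne_zero (ne_zero_of_notMem ht) hx0 hd
  obtain ⟨u, q, hu, huc | ⟨hq, hua⟩⟩ := h.mul_eq_mul_or hQ (c := c) ha0
  · exact ⟨u, hu, huc ▸ J.mul_mem_left q ha⟩
  · exfalso
    have hc0 : c ≠ 0 := by
      rintro rfl
      rw [mul_zero] at hua
      exact mul_ne_zero (ne_zero_of_notMem hu) ha0 hua
    have hcK : algebraMap D K c ≠ 0 := by
      rwa [Ne, FaithfulSMul.algebraMap_eq_zero_iff]
    refine Q.isPrime.mul_notMem ht hu ?_
    rw [← hQ.1.2.closure_eq]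
    change algebraMap D K (t * u) ∈ star.finType.onIdeal Q.asIdeal
    have h1 : algebraMap D K (t * u) = (algebraMap D K (t * u) / algebraMap D K c) *
        algebraMap D K c := by
      rw [div_mul_cancel₀ _ hcK]
    rw [h1]
    refine star.finType.mul_mem_of_smul_le hc ?_
    intro y hy
    obtain ⟨_, ⟨b, hb, rfl⟩, rfl⟩ := (Submodule.mem_smul_pointwise_iff_exists _ _ _).1 hy
    obtain ⟨d, hd⟩ := hta b hb
    refine ⟨q * d, Ideal.mul_mem_right _ _ hq, ?_⟩
    rw [Algebra.linearMap_apply, Algebra.linearMap_apply, smul_eq_mul, div_mul_eq_mul_div,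
      eq_div_iff hcK, ← map_mul, ← map_mul]
    congr 1
    linear_combination -d * hua - u * hd

theorem IsDedekind.exists_fg_extend_eq {star : SemistarOperation D K} (h : star.IsDedekind)
    {I : Ideal D} (hI : I ≠ ⊥) :
    ∃ J : Ideal D, J ≠ ⊥ ∧ J.FG ∧ J ≤ I ∧
      ∀ Q ∈ star.quasiMaximalSpectrum, extend Q I = extend Q J := by
  obtain ⟨J, hJ0, hJfg, hJI, hIJ⟩ := h.1.exists_fg_le_closure hI
  refine ⟨J, hJ0, hJfg, hJI, tilde_onIdeal_eq_iff.1 (le_antisymm ?_ (star.tilde.onIdeal_mono hJI))⟩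
  exact star.tilde.onIdeal_le_of_le_closure
    (hIJ.trans (h.2.closure_le_tilde_closure hJ0 hJfg))

theorem IsDedekind.isDiscreteValuationRing {star : SemistarOperation D K} (h : star.IsDedekind)
    {Q : PrimeSpectrum D} (hQ : Q ∈ star.quasiMaximalSpectrum) :
    IsDiscreteValuationRing (Localization.AtPrime Q.asIdeal) := by
  have : IsPrincipalIdealRing (Localization.AtPrime Q.asIdeal) := by
    refine ⟨fun 𝔞 => ?_⟩
    have hmap : extend Q (𝔞.under D) = 𝔞 := IsLocalization.map_under Q.asIdeal.primeCompl _ 𝔞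
    by_cases h0 : 𝔞.under D = ⊥
    · rw [← hmap, h0, extend, Ideal.map_bot]
      exact bot_isPrincipal
    obtain ⟨J, hJ0, hJfg, -, hJ⟩ := h.exists_fg_extend_eq h0
    obtain ⟨a, ha, s, hs, hd⟩ := h.2.exists_generator hQ hJ0 hJfg
    refine ⟨algebraMap D _ a, ?_⟩
    rw [← hmap, hJ Q hQ]
    change _ = Ideal.span _
    rw [← Set.image_singleton, ← Ideal.map_span]
    refine le_antisymm (extend_le_iff.2 fun c hc => ⟨s, hs, ?_⟩)
      (Ideal.map_mono ((Ideal.span_singleton_le_iff_mem _).2 ha))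
    obtain ⟨d, hd⟩ := hd c hc
    exact Ideal.mem_span_singleton.2 ⟨d, hd⟩
  exact { not_a_field' := maximalIdeal_ne_bot hQ }

/-- An ideal `M` maximal among the nonzero ideals lying in infinitely many quasi-maximal ideals is
prime. It is contained in some `Q`, hence equals `Q`, which lies in only one quasi-maximal ideal. -/
theorem IsDedekind.finite_quasiMaximal {star : SemistarOperation D K} (h : star.IsDedekind)
    {I : Ideal D} (hI : I ≠ ⊥) : {Q ∈ star.quasiMaximalSpectrum | I ≤ Q.asIdeal}.Finite := by
  by_contra hinf
  set S : Set (Ideal D) :=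
    {J | J ≠ ⊥ ∧ ¬ {Q ∈ star.quasiMaximalSpectrum | J ≤ Q.asIdeal}.Finite} with hS
  have hsup : ∀ c ⊆ S, IsChain (· ≤ ·) c → ∀ y ∈ c, ∃ ub ∈ S, ∀ z ∈ c, z ≤ ub := by
    intro c hcs hc y hy
    have hne : sSup c ≠ ⊥ := fun h0 => (hcs hy).1 (le_bot_iff.1 (h0 ▸ le_sSup hy))
    refine ⟨sSup c, ⟨hne, fun hfin => ?_⟩, fun z hz => le_sSup hz⟩
    -- The union of the chain agrees locally with a finitely generated `J`, which lies in one member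
    -- `A`; every quasi-maximal ideal over `A` then contains the whole union.
    obtain ⟨J, hJ0, hJfg, hJ, hJext⟩ := h.exists_fg_extend_eq hne
    obtain ⟨A, hA, hJA⟩ := exists_le_coeSubmodule_of_isChain (K := K) hc ⟨y, hy⟩
      (Submodule.FG.map (Algebra.linearMap D K) hJfg) (Submodule.map_mono hJ)
    have hJA' : J ≤ A := fun x hx => by
      obtain ⟨a, ha, hax⟩ := hJA ⟨x, hx, rfl⟩
      rwa [← IsFractionRing.injective D K hax]
    refine (hcs hA).2 (hfin.subset fun Q hQ => ⟨hQ.1, ?_⟩)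
    by_contra hnot
    rw [← extend_eq_top_iff, hJext Q hQ.1, extend_eq_top_iff] at hnot
    exact hnot (hJA'.trans hQ.2)
  obtain ⟨M, -, hM⟩ := zorn_le_nonempty₀ S hsup I ⟨hI, hinf⟩
  have hMS : M ∈ S := hM.1
  have hbigger : ∀ a, a ∉ M →
      {Q ∈ star.quasiMaximalSpectrum | M ⊔ Ideal.span {a} ≤ Q.asIdeal}.Finite := by
    intro a ha
    by_contra hnot
    have hmem : M ⊔ Ideal.span {a} ∈ S :=
      ⟨fun h0 => hMS.1 (le_bot_iff.1 (h0 ▸ le_sup_left)), hnot⟩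
    exact ha (hM.2 hmem le_sup_left
      (Ideal.mem_sup_right (Ideal.mem_span_singleton_self a)))
  obtain ⟨Q, hQ, hMQ⟩ : {Q ∈ star.quasiMaximalSpectrum | M ≤ Q.asIdeal}.Nonempty :=
    Set.Infinite.nonempty hMS.2
  have hprime : M.IsPrime := by
    refine Ideal.isPrime_iff.2 ⟨fun htop => Q.isPrime.ne_top (top_le_iff.1 (htop ▸ hMQ)), ?_⟩
    intro a b hab
    by_contra! hcon
    refine hMS.2 (((hbigger a hcon.1).union (hbigger b hcon.2)).subset fun R hR => ?_)
    rcases R.isPrime.mem_or_mem (hR.2 hab) with ha | hb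
    · exact Or.inl ⟨hR.1, sup_le hR.2 ((Ideal.span_singleton_le_iff_mem _).2 ha)⟩
    · exact Or.inr ⟨hR.1, sup_le hR.2 ((Ideal.span_singleton_le_iff_mem _).2 hb)⟩
  have hMQ' := eq_of_isPrime_of_le (h.isDiscreteValuationRing hQ) hprime hMS.1 hMQ
  refine hMS.2 ((Set.finite_singleton Q).subset fun R hR => ?_)
  exact (eq_of_le_of_mem_quasiMaximalSpectrum hQ hR.1 (hMQ' ▸ hR.2)).symm

theorem IsDedekind.isLocallyDVROfFiniteCharacter {star : SemistarOperation D K}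
    (h : star.IsDedekind) : star.IsLocallyDVROfFiniteCharacter :=
  ⟨fun _ hQ => h.isDiscreteValuationRing hQ, fun _ hI => h.finite_quasiMaximal hI⟩

/-! ### Localizing a factorization. -/

section ExtendProd

variable {D : Type*} [CommRing D]

theorem extend_prod_pow (Q : PrimeSpectrum D) {n : ℕ} (P : Fin n → Ideal D) (e : Fin n → ℕ) :
    extend Q (∏ i, P i ^ e i) = ∏ i, extend Q (P i) ^ e i := by
  rw [extend, ← Ideal.mapHom_apply, map_prod]
  simp only [Ideal.mapHom_apply, Ideal.map_pow]

theorem extend_pow_eq_one {Q : PrimeSpectrum D} {I : Ideal D} (h : ¬ I ≤ Q.asIdeal) (n : ℕ) :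
    extend Q I ^ n = 1 := by
  rw [extend_eq_top_iff.2 h, ← Ideal.one_eq_top, one_pow]

theorem extend_prod_pow_eq_top {Q : PrimeSpectrum D} {n : ℕ} {P : Fin n → Ideal D}
    (e : Fin n → ℕ) (h : ∀ i, ¬ P i ≤ Q.asIdeal) : extend Q (∏ i, P i ^ e i) = ⊤ := by
  rw [extend_prod_pow, ← Ideal.one_eq_top]
  exact Finset.prod_eq_one fun i _ => extend_pow_eq_one (h i) _

theorem extend_prod_pow_eq {Q : PrimeSpectrum D} {n : ℕ} {P : Fin n → Ideal D}
    (e : Fin n → ℕ) {i : Fin n} (h : ∀ j, j ≠ i → ¬ P j ≤ Q.asIdeal) :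
    extend Q (∏ i, P i ^ e i) = extend Q (P i) ^ e i := by
  rw [extend_prod_pow]
  exact Finset.prod_eq_single i (fun j _ hj => extend_pow_eq_one (h j hj) _)
    fun hi => (hi (Finset.mem_univ i)).elim

end ExtendProd

section Factorization

variable {D K : Type*} [CommRing D] [Field K] [Algebra D K] [IsFractionRing D K]

/-- By comaximality at most one `P i` lies under `Q`; the other factors become the unit ideal. -/
theorem IsFactorization.extend_eq_top_or {star : SemistarOperation D K} {I : Ideal D} {n : ℕ}
    {P : Fin n → Ideal D} {e : Fin n → ℕ} (h : star.IsFactorization I P e)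
    {Q : PrimeSpectrum D} (hQ : Q ∈ star.quasiMaximalSpectrum) :
    (extend Q I = ⊤ ∧ ∀ i, ¬ P i ≤ Q.asIdeal) ∨
      ∃ i, P i ≤ Q.asIdeal ∧ extend Q I = extend Q (P i) ^ e i := by
  have hI := tilde_onIdeal_eq_iff.1 h.eq_prod Q hQ
  by_cases hP : ∃ i, P i ≤ Q.asIdeal
  · obtain ⟨i, hi⟩ := hP
    refine Or.inr ⟨i, hi, hI.trans (extend_prod_pow_eq e fun j hj hjQ => ?_)⟩
    exact (comaximal_finType_iff (h.quasiPrime j).2.1).1 (h.comaximal j i hj) Q hQ hjQ hi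
  · push Not at hP
    exact Or.inl ⟨hI.trans (extend_prod_pow_eq_top e hP), hP⟩

end Factorization

/-! ### Consequences of the local condition. -/

namespace IsLocallyDVROfFiniteCharacter

variable {D K : Type*} [CommRing D] [IsDomain D] [Field K] [Algebra D K]
  {star : SemistarOperation D K}

theorem exists_generator (h : star.IsLocallyDVROfFiniteCharacter) {Q : PrimeSpectrum D}
    (hQ : Q ∈ star.quasiMaximalSpectrum) (I : Ideal D) :
    ∃ a ∈ I, extend Q I = extend Q (Ideal.span {a}) := by
  have := h.dvr Q hQ
  obtain ⟨x, hx⟩ := IsPrincipalIdealRing.principal (extend Q I)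
  have hx' : extend Q I = Ideal.span {x} := hx
  have hxI : x ∈ extend Q I := hx' ▸ Ideal.mem_span_singleton_self x
  obtain ⟨⟨a, s⟩, hs⟩ := (IsLocalization.mem_map_algebraMap_iff Q.asIdeal.primeCompl _).1 hxI
  refine ⟨a, a.2, ?_⟩
  have hspan : extend Q (Ideal.span {a.1}) = Ideal.span {algebraMap D _ a.1} := by
    rw [extend, Ideal.map_span, Set.image_singleton]
  rw [hspan, ← hs, hx', Ideal.span_singleton_mul_right_unit (IsLocalization.map_units _ s)]

/-- A nonzero `x ∈ I` generates the unit ideal at all but finitely many `Q`; one local generator of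
`I` is adjoined for each exception. -/
theorem exists_fg_extend_eq (h : star.IsLocallyDVROfFiniteCharacter) {I : Ideal D} (hI : I ≠ ⊥) :
    ∃ J : Ideal D, J.FG ∧ J ≤ I ∧
      ∀ Q ∈ star.quasiMaximalSpectrum, extend Q I = extend Q J := by
  obtain ⟨x, hx, hx0⟩ := Submodule.exists_mem_ne_zero_of_ne_bot hI
  have hx' : Ideal.span {x} ≠ ⊥ := by rwa [Ne, Ideal.span_singleton_eq_bot]
  have hgen : ∀ Q : PrimeSpectrum D, ∃ a ∈ I, Q ∈ star.quasiMaximalSpectrum →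
      extend Q I = extend Q (Ideal.span {a}) := by
    intro Q
    by_cases hQ : Q ∈ star.quasiMaximalSpectrum
    · obtain ⟨a, ha, hIa⟩ := h.exists_generator hQ I
      exact ⟨a, ha, fun _ => hIa⟩
    · exact ⟨x, hx, fun hQ' => (hQ hQ').elim⟩
  choose a haI ha using hgen
  set T : Set D := insert x (a '' {Q ∈ star.quasiMaximalSpectrum | Ideal.span {x} ≤ Q.asIdeal})
  have hTI : Ideal.span T ≤ I := by
    refine Ideal.span_le.2 (Set.insert_subset hx ?_)
    rintro _ ⟨Q, -, rfl⟩
    exact haI Q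
  refine ⟨Ideal.span T, Submodule.fg_span (((h.finite _ hx').image a).insert x), hTI,
    fun Q hQ => le_antisymm ?_ (Ideal.map_mono hTI)⟩
  by_cases hxQ : Ideal.span {x} ≤ Q.asIdeal
  · rw [ha Q hQ]
    exact Ideal.map_mono ((Ideal.span_singleton_le_iff_mem _).2 (Ideal.subset_span
      (Set.mem_insert_of_mem _ ⟨Q, ⟨hQ, hxQ⟩, rfl⟩)))
  · refine le_top.trans ((extend_eq_top_iff.2 hxQ).ge.trans (Ideal.map_mono ?_))
    exact (Ideal.span_singleton_le_iff_mem _).2 (Ideal.subset_span (Set.mem_insert _ _))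

theorem exists_extend_eq_pow (h : star.IsLocallyDVROfFiniteCharacter) {Q : PrimeSpectrum D}
    (hQ : Q ∈ star.quasiMaximalSpectrum) {I : Ideal D} (hI : I ≠ ⊥) :
    ∃ e, extend Q I = extend Q Q.asIdeal ^ e := by
  have := h.dvr Q hQ
  rw [extend_self]
  exact exists_maximalIdeal_pow_eq_of_principal _ (IsPrincipalIdealRing.principal _) _
    (extend_ne_bot hI)

theorem exists_eq_of_isQuasiPrime (h : star.IsLocallyDVROfFiniteCharacter) {P : Ideal D}
    (hP : star.finType.IsQuasiPrime P) : ∃ Q ∈ star.quasiMaximalSpectrum, P = Q.asIdeal := by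
  obtain ⟨Q, hQ, hPQ⟩ := hP.exists_le_quasiMaximal
  exact ⟨Q, hQ, eq_of_isPrime_of_le (h.dvr Q hQ) hP.1 hP.2.1 hPQ⟩

theorem pow_extend_injective (h : star.IsLocallyDVROfFiniteCharacter) {Q : PrimeSpectrum D}
    (hQ : Q ∈ star.quasiMaximalSpectrum) :
    Function.Injective fun e : ℕ => extend Q Q.asIdeal ^ e := by
  have := h.dvr Q hQ
  rw [extend_self]
  exact (Ideal.pow_right_strictAnti _ (maximalIdeal_ne_bot hQ)
    (IsLocalRing.maximalIdeal.isMaximal _).ne_top).injective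

end IsLocallyDVROfFiniteCharacter

/-! ### From factorizations to the local condition, and back. -/

variable {D K : Type*} [CommRing D] [IsDomain D] [Field K] [Algebra D K] [IsFractionRing D K]

theorem isDiscreteValuationRing_of_factorization {star : SemistarOperation D K}
    (h : ∀ I : Ideal D, I ≠ ⊥ →
      ∃ (n : ℕ) (P : Fin n → Ideal D) (e : Fin n → ℕ), star.IsFactorization I P e)
    {Q : PrimeSpectrum D} (hQ : Q ∈ star.quasiMaximalSpectrum) :
    IsDiscreteValuationRing (Localization.AtPrime Q.asIdeal) := by
  refine isDiscreteValuationRing_of_forall_span_singleton_eq_pow (maximalIdeal_ne_bot hQ)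
    fun x hx => ?_
  set 𝔞 : Ideal (Localization.AtPrime Q.asIdeal) := Ideal.span {x}
  have hmap : extend Q (𝔞.under D) = 𝔞 := IsLocalization.map_under Q.asIdeal.primeCompl _ 𝔞
  have h0 : 𝔞.under D ≠ ⊥ := by
    intro h0
    rw [h0, extend, Ideal.map_bot] at hmap
    exact hx (Ideal.span_singleton_eq_bot.1 hmap.symm)
  obtain ⟨n, P, e, hf⟩ := h _ h0
  rw [← hmap]
  rcases hf.extend_eq_top_or hQ with ⟨htop, -⟩ | ⟨i, hi, hie⟩
  -- The unit ideal is the zeroth power of the maximal ideal.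
  · exact ⟨_, (IsLocalRing.maximalIdeal.isMaximal _).isPrime, 0, by
      rw [htop, pow_zero, Ideal.one_eq_top]⟩
  · exact ⟨_, extend_isPrime (hf.quasiPrime i).1 hi, e i, hie⟩

theorem isLocallyDVROfFiniteCharacter_of_factorization {star : SemistarOperation D K}
    (h : ∀ I : Ideal D, I ≠ ⊥ →
      ∃ (n : ℕ) (P : Fin n → Ideal D) (e : Fin n → ℕ), star.IsFactorization I P e) :
    star.IsLocallyDVROfFiniteCharacter := by
  refine ⟨fun Q hQ => isDiscreteValuationRing_of_factorization h hQ, fun I hI => ?_⟩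
  obtain ⟨n, P, e, hf⟩ := h I hI
  refine Set.Finite.of_finite_image (f := PrimeSpectrum.asIdeal)
    ((Set.finite_range P).subset ?_) fun _ _ _ _ hQR => PrimeSpectrum.ext hQR
  rintro _ ⟨Q, ⟨hQ, hIQ⟩, rfl⟩
  rcases hf.extend_eq_top_or hQ with ⟨htop, -⟩ | ⟨i, hi, -⟩
  · exact (extend_eq_top_iff.1 htop hIQ).elim
  · exact ⟨i, eq_of_isPrime_of_le (isDiscreteValuationRing_of_factorization h hQ)
      (hf.quasiPrime i).1 (hf.quasiPrime i).2.1 hi⟩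

namespace IsLocallyDVROfFiniteCharacter

variable {star : SemistarOperation D K}

/-- If `I I⁻¹ ⊆ Q`, let `a ∈ I` generate `I` at `Q`. A common denominator `s ∉ Q` gives `s / a ∈
I⁻¹`, so `s = a (s / a)` lies in `I I⁻¹ ⊆ Q`, a contradiction. -/
theorem isPruferMultiplicationDomain (h : star.IsLocallyDVROfFiniteCharacter) :
    star.IsPruferMultiplicationDomain := by
  intro I hI hfg
  set E : Submodule D K := IsLocalization.coeSubmodule K I *
    ((1 : Submodule D K) / IsLocalization.coeSubmodule K I) with hE
  have hE1 : E ≤ 1 := by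
    rw [hE, Submodule.mul_le]
    intro m hm n hn
    rw [mul_comm]
    exact Submodule.mem_div_iff_forall_mul_mem.1 hn m hm
  set A : Ideal D := E.comap (Algebra.linearMap D K)
  have hA : IsLocalization.coeSubmodule K A = E := by
    refine Submodule.map_comap_eq_of_le ?_
    rwa [← Submodule.one_eq_range]
  have hIA : I ≤ A := by
    intro c hc
    have : algebraMap D K c * 1 ∈ E := Submodule.mul_mem_mul ⟨c, hc, rfl⟩
      (Submodule.mem_div_iff_forall_mul_mem.2 fun y hy => by
        obtain ⟨d, -, rfl⟩ := hy
        exact Submodule.mem_one.2 ⟨d, by simp⟩)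
    rwa [mul_one] at this
  have hA0 : A ≠ ⊥ := fun h0 => hI (le_bot_iff.1 (h0 ▸ hIA))
  change star.finType E = _
  rw [← hA]
  change star.finType.onIdeal A = _
  rw [onIdeal_eq_one_iff, finType_closure_eq_top_iff hA0]
  intro Q hQ hAQ
  obtain ⟨a, ha, hIa⟩ := h.exists_generator hQ I
  have ha0 : a ≠ 0 := by
    rintro rfl
    refine extend_ne_bot (Q := Q) hI ?_
    rw [hIa, Ideal.span_singleton_eq_bot.2 rfl, extend, Ideal.map_bot]
  have haK : algebraMap D K a ≠ 0 := by rwa [Ne, FaithfulSMul.algebraMap_eq_zero_iff]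
  -- Finite generation allows a single denominator: the product of those of the generators.
  obtain ⟨s, hs, hsI⟩ : ∃ s, s ∉ Q.asIdeal ∧ ∀ c ∈ I, s * c ∈ Ideal.span {a} := by
    obtain ⟨S, rfl⟩ := hfg
    have hS : ∀ c ∈ S, ∃ s, s ∉ Q.asIdeal ∧ s * c ∈ Ideal.span {a} := fun c hc =>
      extend_le_iff.1 hIa.le c (Ideal.subset_span hc)
    choose! t ht using hS
    refine ⟨∏ c ∈ S, t c, ?_, fun c hc => ?_⟩
    · rw [Q.isPrime.prod_mem_iff]
      rintro ⟨c, hc, hcQ⟩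
      exact (ht c hc).1 hcQ
    · induction hc using Submodule.span_induction with
      | mem c hc =>
        obtain ⟨r, hr⟩ := Finset.dvd_prod_of_mem t hc
        rw [hr, show t c * r * c = r * (t c * c) by ring]
        exact Ideal.mul_mem_left _ _ (ht c hc).2
      | zero => simp
      | add x y _ _ hx hy => rw [mul_add]; exact add_mem hx hy
      | smul r x _ hx =>
        rw [smul_eq_mul, mul_left_comm]
        exact Ideal.mul_mem_left _ _ hx
  refine hs (hAQ ?_)
  have : algebraMap D K a * (algebraMap D K s / algebraMap D K a) ∈ E := by
    refine Submodule.mul_mem_mul ⟨a, ha, rfl⟩ (Submodule.mem_div_iff_forall_mul_mem.2 ?_)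
    rintro _ ⟨c, hc, rfl⟩
    obtain ⟨d, hd⟩ := Ideal.mem_span_singleton.1 (hsI c hc)
    refine Submodule.mem_one.2 ⟨d, ?_⟩
    rw [Algebra.linearMap_apply, div_mul_eq_mul_div, eq_div_iff haK, ← map_mul, ← map_mul, hd,
      mul_comm]
  rwa [mul_div_cancel₀ _ haK] at this

/-- The union of the chain agrees locally with a finitely generated `J`, contained in some `A n`.
Every later term then lies in the `⋆~`-closure of `A n`, hence in its `⋆_f`-closure, which is `A n`.
-/
theorem isNoetherianDomain (h : star.IsLocallyDVROfFiniteCharacter) :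
    star.IsNoetherianDomain := by
  rw [IsNoetherianDomain, wellFoundedGT_iff_monotone_chain_condition]
  intro A
  have hdir : Directed (· ≤ ·) fun n => (A n).1 :=
    Monotone.directed_le fun m n hmn => A.monotone hmn
  have hne : (⨆ n, (A n).1) ≠ ⊥ := fun h0 =>
    (A 0).2.1 (le_bot_iff.1 (h0 ▸ le_iSup (fun n => (A n).1) 0))
  obtain ⟨J, hJfg, hJ, hext⟩ := h.exists_fg_extend_eq hne
  obtain ⟨n, hn⟩ : ∃ n, J ≤ (A n).1 := by
    have hc := (CompleteLattice.isCompactElement_iff_le_of_directed_sSup_le _ _).1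
      ((Submodule.fg_iff_compact J).1 hJfg) _ (Set.range_nonempty fun n => (A n).1)
      hdir.directedOn_range hJ
    obtain ⟨_, ⟨n, rfl⟩, hn⟩ := hc
    exact ⟨n, hn⟩
  refine ⟨n, fun m hm => le_antisymm (A.monotone hm) ?_⟩
  have hq := (A n).2
  have h1 : (A m).1 ≤ star.tilde.closure (A n).1 := by
    refine (le_iSup (fun n => (A n).1) m).trans (LE.le.trans ?_ (star.tilde.closure_mono hn))
    exact (star.tilde.le_closure _).trans
      (Submodule.comap_mono (tilde_onIdeal_eq_iff.2 hext).le)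
  change (A m).1 ≤ (A n).1
  calc (A m).1 ≤ star.tilde.closure (A n).1 := h1
    _ ≤ star.finType.closure (A n).1 := tilde_closure_le_finType_closure hq.1
    _ = (A n).1 := hq.finType.closure_eq

theorem isDedekind (h : star.IsLocallyDVROfFiniteCharacter) : star.IsDedekind :=
  ⟨h.isNoetherianDomain, h.isPruferMultiplicationDomain⟩

/-- The factors are the quasi-maximal ideals containing `I`, with exponents read off in each `D_Q`;
distinct ones are comaximal because neither contains the other. -/
theorem exists_factorization (h : star.IsLocallyDVROfFiniteCharacter) {I : Ideal D} (hI : I ≠ ⊥) :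
    ∃ (n : ℕ) (P : Fin n → Ideal D) (e : Fin n → ℕ),
      star.IsFactorization I P e ∧ ∀ i, 0 < e i := by
  have : Finite {Q // Q ∈ star.quasiMaximalSpectrum ∧ I ≤ Q.asIdeal} :=
    (h.finite I hI).to_subtype
  obtain ⟨n, ⟨σ⟩⟩ := Finite.exists_equiv_fin
    {Q // Q ∈ star.quasiMaximalSpectrum ∧ I ≤ Q.asIdeal}
  choose e he using fun i => h.exists_extend_eq_pow (σ.symm i).2.1 hI
  have hle : ∀ (Q : PrimeSpectrum D), Q ∈ star.quasiMaximalSpectrum → ∀ i,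
      (σ.symm i).1.asIdeal ≤ Q.asIdeal → (σ.symm i).1 = Q := fun Q hQ i hi =>
    eq_of_le_of_mem_quasiMaximalSpectrum (σ.symm i).2.1 hQ hi
  refine ⟨n, fun i => (σ.symm i).1.asIdeal, e, ⟨fun i => ⟨(σ.symm i).1.isPrime,
    (σ.symm i).2.1.1.2⟩, fun i j hij => ?_, ?_⟩, fun i => Nat.pos_of_ne_zero fun h0 => ?_⟩
  · rw [comaximal_finType_iff (ne_bot_of_mem_quasiMaximalSpectrum (σ.symm i).2.1)]
    intro Q hQ hi hj
    exact hij (σ.symm.injective (Subtype.ext ((hle Q hQ i hi).trans (hle Q hQ j hj).symm)))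
  · rw [tilde_onIdeal_eq_iff]
    intro Q hQ
    by_cases hIQ : I ≤ Q.asIdeal
    · obtain ⟨i, hi⟩ := σ.symm.surjective ⟨Q, hQ, hIQ⟩
      obtain rfl : (σ.symm i).1 = Q := congrArg Subtype.val hi
      rw [he i, extend_prod_pow_eq e (i := i)]
      exact fun j hj hjQ => hj (σ.symm.injective (Subtype.ext (hle _ hQ j hjQ)))
    · rw [extend_eq_top_iff.2 hIQ, extend_prod_pow_eq_top e]
      exact fun i hi => hIQ (hle Q hQ i hi ▸ (σ.symm i).2.2)
  · have h1 := he i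
    rw [h0, pow_zero, Ideal.one_eq_top, extend_eq_top_iff] at h1
    exact h1 (σ.symm i).2.2

/-- The primes of a factorization with positive exponents of `I` occur in every other
factorization of `I`, with the same exponents. -/
theorem exists_eq_of_isFactorization (h : star.IsLocallyDVROfFiniteCharacter) {I : Ideal D}
    {n m : ℕ} {P : Fin n → Ideal D} {e : Fin n → ℕ} {Q : Fin m → Ideal D} {f : Fin m → ℕ}
    (hP : star.IsFactorization I P e) (he : ∀ i, 0 < e i) (hQ : star.IsFactorization I Q f)
    (i : Fin n) : ∃ j, P i = Q j ∧ e i = f j := by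
  -- Localizing at `R = P i` isolates the exponent `e i`. As `e i > 0`, the extension of `I` is
  -- proper, so the second factorization must have a prime under `R`, which then equals `R`.
  obtain ⟨R, hR, hPR⟩ := h.exists_eq_of_isQuasiPrime (hP.quasiPrime i)
  have hIe : extend R I = extend R R.asIdeal ^ e i := by
    rcases hP.extend_eq_top_or hR with ⟨-, hnot⟩ | ⟨k, hk, hIk⟩
    · exact (hnot i hPR.le).elim
    · obtain rfl : k = i := by
        by_contra hki
        exact (comaximal_finType_iff (hP.quasiPrime k).2.1).1 (hP.comaximal k i hki) R hR hk hPR.le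
      rw [hIk, hPR]
  rcases hQ.extend_eq_top_or hR with ⟨htop, -⟩ | ⟨j, hj, hIj⟩
  · refine ((he i).ne' (h.pow_extend_injective hR ?_)).elim
    change extend R R.asIdeal ^ e i = extend R R.asIdeal ^ 0
    rw [← hIe, htop, pow_zero, Ideal.one_eq_top]
  · have hQR := eq_of_isPrime_of_le (h.dvr R hR) (hQ.quasiPrime j).1 (hQ.quasiPrime j).2.1 hj
    refine ⟨j, hPR.trans hQR.symm, h.pow_extend_injective hR ?_⟩
    change extend R R.asIdeal ^ e i = extend R R.asIdeal ^ f j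
    rw [← hIe, hIj, hQR]

end IsLocallyDVROfFiniteCharacter

end SemistarOperation

theorem theorem4p23 {D K : Type*} [CommRing D] [IsDomain D] [Field K] [Algebra D K]
    [IsFractionRing D K] (star : SemistarOperation D K) :
    (star.IsDedekind ↔
      ∀ I : Ideal D, I ≠ ⊥ →
        ∃ (n : ℕ) (P : Fin n → Ideal D) (e : Fin n → ℕ), star.IsFactorization I P e) ∧
    ((∀ I : Ideal D, I ≠ ⊥ →
        ∃ (n : ℕ) (P : Fin n → Ideal D) (e : Fin n → ℕ), star.IsFactorization I P e) →
      ∀ I : Ideal D, I ≠ ⊥ → star.tilde.onIdeal I ≠ star.tilde 1 →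
        (∃ (n : ℕ) (P : Fin n → Ideal D) (e : Fin n → ℕ), star.IsFactorization I P e ∧
          (∀ i, star.tilde.onIdeal (P i) ≠ star.tilde 1) ∧ ∀ i, 0 < e i) ∧
        ∀ (n m : ℕ) (P : Fin n → Ideal D) (e : Fin n → ℕ) (Q : Fin m → Ideal D) (f : Fin m → ℕ),
          star.IsFactorization I P e →
          (∀ i, star.tilde.onIdeal (P i) ≠ star.tilde 1) → (∀ i, 0 < e i) →
          star.IsFactorization I Q f →
          (∀ j, star.tilde.onIdeal (Q j) ≠ star.tilde 1) → (∀ j, 0 < f j) →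
          ∃ σ : Fin n ≃ Fin m, ∀ i, P i = Q (σ i) ∧ e i = f (σ i)) := by
  refine ⟨⟨fun h I hI => ?_, fun h => ?_⟩, fun h I hI _ => ⟨?_, ?_⟩⟩
  · obtain ⟨n, P, e, hP, -⟩ := h.isLocallyDVROfFiniteCharacter.exists_factorization hI
    exact ⟨n, P, e, hP⟩
  · exact (SemistarOperation.isLocallyDVROfFiniteCharacter_of_factorization h).isDedekind
  · obtain ⟨n, P, e, hP, he⟩ :=
      (SemistarOperation.isLocallyDVROfFiniteCharacter_of_factorization h).exists_factorization hI
    refine ⟨n, P, e, hP, fun i => ?_, he⟩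
    obtain ⟨Q, hQ, hPQ⟩ := (hP.quasiPrime i).exists_le_quasiMaximal
    exact fun h1 => SemistarOperation.tilde_onIdeal_eq_one_iff.1 h1 Q hQ hPQ
  · intro n m P e Q f hP _ he hQ _ hf
    have hC := SemistarOperation.isLocallyDVROfFiniteCharacter_of_factorization h
    -- The matchings in the two directions are mutually inverse because each family of primes is
    -- injective.
    choose σ hσ using hC.exists_eq_of_isFactorization hP he hQ
    choose τ hτ using hC.exists_eq_of_isFactorization hQ hf hP
    exact ⟨⟨σ, τ, fun i => hP.injective ((hσ i).1.trans (hτ (σ i)).1).symm,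
      fun j => hQ.injective ((hτ j).1.trans (hσ (τ j)).1).symm⟩, hσ⟩
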